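/- Fix an acceptable numbering $\varphi_0,\varphi_1,\dots$ of the partial recursive functions, and let $W_e$ be the domain of $\varphi_e$. Let $\eta$ be a positive (that is, recursively enumerable) equivalence relation on $\mathbb N$ with infinitely many equivalence classes, and write $[D]$ for the union of the $\eta$-classes of the elements of $D\subseteq\mathbb N$. A set is $\eta$-infinite if it is the union of infinitely many $\eta$-classes. An $\eta$-family is a family $\{B_0,B_1,\dots\}$ of pairwise distinct sets, each a union of $\eta$-classes, such that $\{(k,x): x\in B_k\}$ is r.e. A text for $L\subseteq\mathbb N$ is a map $T:\mathbb N\to\mathbb N\cup\{\#\}$ whose range without $\#$ is $L$; $T[n]$ is the sequence $T(0),\dots,T(n-1)$. A learner is a (total) recursive function $M$ from finite sequences over $\mathbb N\cup\{\#\}$ to $\mathbb N\cup\{?\}$. An output $e\in\mathbb N$ is correct for $L$ if $[W_e]=L$; the output $?$ is never correct. The learner $M$ learns a class $\mathcal C$ - explanatorily if for every $L\in\mathcal C$ and every text $T$ for $L$ there is an $n$ such that $M(T[n])$ is correct for $L$ and $M(T[j])=M(T[n])$ for all $j\ge n$; - behaviourally correctly if for every $L\in\mathcal C$ and every text $T$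 for $L$ there is an $n$ such that $M(T[j])$ is correct for $L$ for all $j\ge n$; - vacillatorily if it learns $\mathcal C$ behaviourally correctly and, for every $L\in\mathcal C$ and every text $T$ for $L$, the set $\{M(T[n]): n\ge 1\}$ is finite. A class is explanatorily (resp. vacillatorily, behaviourally correctly) learnable if some learner learns it in that sense. Behaviourally correct learning is closed under union with respect to $\eta$ if, for all behaviourally correctly learnable $\eta$-families $\mathcal L,\mathcal H$ such that $\mathcal L\cup\mathcal H$ is an $\eta$-family, $\mathcal L\cup\mathcal H$ is behaviourally correctly learnable. Theorem. For every such $\eta$: (a) There are disjoint, explanatorily (resp. vacillatorily) learnable $\eta$-families $\mathcal L_1$ and $\mathcal L_2$ for which $\mathcal L_1\cup\mathcal L_2$ is an $\eta$-family that is not explanatorily (resp. vacillatorily) learnable. (b) Behaviourally correct learning is closed under union with respect to $\eta$ if and only if $\mathbb N$ is the only $\eta$-infinite r.e. set. -/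

import Mathlib

namespace EtaLearning

/-- A numbering `φ` of partial recursive functions is acceptable if it is itself partial recursive
(in both arguments) and every numbering `ψ` of partial recursive functions translates into it by a
recursive function. In particular every partial recursive function is some `φ e`. -/
def IsAcceptable (φ : ℕ → ℕ →. ℕ) : Prop :=
  Partrec₂ φ ∧
    ∀ ψ : ℕ → ℕ →. ℕ, Partrec₂ ψ → ∃ c : ℕ → ℕ, Computable c ∧ ∀ e, ψ e = φ (c e)

/-- The `e`-th r.e. set `W_e`, the domain of `φ e`. -/
def W (φ : ℕ → ℕ →. ℕ) (e : ℕ) : Set ℕ := (φ e).Dom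

/-- A positive equivalence relation on `ℕ`: it is recursively enumerable as a set of pairs, and it
has infinitely many equivalence classes. -/
structure IsPositive (η : Setoid ℕ) : Prop where
  re : REPred fun p : ℕ × ℕ => η p.1 p.2
  infinite_classes : Infinite (Quotient η)

/-- The `η`-closure `[D]`, the union of the classes of the elements of `D`. -/
def etaClosure (η : Setoid ℕ) (D : Set ℕ) : Set ℕ := {y | ∃ x ∈ D, η x y}

/-- `A` is a union of `η`-equivalence classes. -/
def EtaClosed (η : Setoid ℕ) (A : Set ℕ) : Prop := ∀ x y : ℕ, η x y → x ∈ A → y ∈ A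

/-- `A` is a union of infinitely many `η`-equivalence classes. -/
def EtaInfinite (η : Setoid ℕ) (A : Set ℕ) : Prop :=
  EtaClosed η A ∧ ((Quotient.mk η) '' A).Infinite

/-- An `η`-family: a family with a uniformly r.e. one-one numbering `B 0, B 1, …` by sets that are
unions of `η`-equivalence classes. (Such a family is infinite since `B` is injective.) -/
def IsEtaFamily (η : Setoid ℕ) (C : Set (Set ℕ)) : Prop :=
  ∃ B : ℕ → Set ℕ, (REPred fun p : ℕ × ℕ => p.2 ∈ B p.1) ∧ Function.Injective B ∧
    Set.range B = C ∧ ∀ k, EtaClosed η (B k)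

/-- `T` is a text for `L`; the pause symbol `#` is `none`. -/
def IsText (T : ℕ → Option ℕ) (L : Set ℕ) : Prop := ∀ x : ℕ, x ∈ L ↔ ∃ n, T n = some x

/-- The initial segment `T[n] = T(0), …, T(n-1)`. -/
def seg (T : ℕ → Option ℕ) (n : ℕ) : List (Option ℕ) := (List.range n).map T

/-- A learner maps finite sequences over `ℕ ∪ {#}` to `ℕ ∪ {?}`; the symbol `?` is `none`. -/
abbrev Learner : Type := List (Option ℕ) → Option ℕ

/-- The output `h` of a learner is a correct hypothesis for `L`: it is a number `e` (not `?`) for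
which the `η`-closure of `W_e` is `L`. -/
def Correct (φ : ℕ → ℕ →. ℕ) (η : Setoid ℕ) (h : Option ℕ) (L : Set ℕ) : Prop :=
  ∃ e : ℕ, h = some e ∧ etaClosure η (W φ e) = L

/-- `M` explanatorily learns the class `C`. -/
def ExLearns (φ : ℕ → ℕ →. ℕ) (η : Setoid ℕ) (M : Learner) (C : Set (Set ℕ)) : Prop :=
  ∀ L ∈ C, ∀ T : ℕ → Option ℕ, IsText T L →
    ∃ n, Correct φ η (M (seg T n)) L ∧ ∀ j ≥ n, M (seg T j) = M (seg T n)

/-- `M` behaviourally correctly learns the class `C`. -/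
def BCLearns (φ : ℕ → ℕ →. ℕ) (η : Setoid ℕ) (M : Learner) (C : Set (Set ℕ)) : Prop :=
  ∀ L ∈ C, ∀ T : ℕ → Option ℕ, IsText T L → ∃ n, ∀ j ≥ n, Correct φ η (M (seg T j)) L

/-- `M` vacillatorily learns the class `C`. -/
def VacLearns (φ : ℕ → ℕ →. ℕ) (η : Setoid ℕ) (M : Learner) (C : Set (Set ℕ)) : Prop :=
  BCLearns φ η M C ∧ ∀ L ∈ C, ∀ T : ℕ → Option ℕ, IsText T L →
    {h : Option ℕ | ∃ n ≥ 1, h = M (seg T n)}.Finite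

/-- `C` is explanatorily learnable (by a recursive learner). -/
def ExLearnable (φ : ℕ → ℕ →. ℕ) (η : Setoid ℕ) (C : Set (Set ℕ)) : Prop :=
  ∃ M : Learner, Computable M ∧ ExLearns φ η M C

/-- `C` is vacillatorily learnable (by a recursive learner). -/
def VacLearnable (φ : ℕ → ℕ →. ℕ) (η : Setoid ℕ) (C : Set (Set ℕ)) : Prop :=
  ∃ M : Learner, Computable M ∧ VacLearns φ η M C

/-- `C` is behaviourally correctly learnable (by a recursive learner). -/
def BCLearnable (φ : ℕ → ℕ →. ℕ) (η : Setoid ℕ) (C : Set (Set ℕ)) : Prop :=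
  ∃ M : Learner, Computable M ∧ BCLearns φ η M C

/-- The learnability notion `I` is closed under union with respect to `η`. -/
def ClosedUnderUnion (η : Setoid ℕ) (I : Set (Set ℕ) → Prop) : Prop :=
  ∀ L H : Set (Set ℕ), IsEtaFamily η L → IsEtaFamily η H → IsEtaFamily η (L ∪ H) →
    I L → I H → I (L ∪ H)

end EtaLearning

/-!
Let `A` be a proper r.e. `η`-infinite subset of `ℕ`, enumerated by `e`, and let `chain η e k` be the
union of the first `k` classes that `e` meets. By Gold's argument no class containing `A` and its
chain is behaviourally correctly learnable, since a finite telltale of `A` lies in some member of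
the chain. Yet the chain is explanatorily learnable, and so is `A` together with the chain of a
sequence which starts at a point outside `A`: whether that point occurs tells the two cases apart.

Suppose now that `ℕ` is the only `η`-infinite r.e. set. By induction on its size, every finite set
lies in infinitely many members of an `η`-family. Hence `ℕ` has no telltale, a behaviourally
correctly learnable family contains only finite unions of classes, and all of these are learnt by
conjecturing the data. For vacillatory learning take the sets `[{0}]` and `[{0, y}]`. After a
locking sequence for `[{0}]` the learner emits only finitely many hypotheses on data from `[{0}]`,
so the `y` for which data from `[{0, y}]` provoke another hypothesis form an `η`-infinite r.e. set
that misses `0`, a contradiction.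
-/

namespace EtaLearning

section RecursivelyEnumerable

variable {α β : Type*} [Primcodable α] [Primcodable β]

theorem exists_stages {p : α → Prop} (hp : REPred p) :
    ∃ v : α → ℕ → Prop, PrimrecRel v ∧ (∀ a, Monotone (v a)) ∧ ∀ a, p a ↔ ∃ n, v a n := by
  obtain ⟨c, hc⟩ := Nat.Partrec.Code.exists_code.1 hp
  refine ⟨fun a n => (Nat.Partrec.Code.evaln n c (Encodable.encode a)).isSome, ?_, ?_, ?_⟩
  · exact Primrec.primrecPred <| (Primrec.option_isSome.comp <| Nat.Partrec.Code.primrec_evaln.comp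
      ((Primrec.snd.pair (Primrec.const c)).pair (Primrec.encode.comp Primrec.fst))).of_eq
      fun q => by simp
  · intro a m n hmn h
    obtain ⟨x, hx⟩ := Option.isSome_iff_exists.1 h
    exact Option.isSome_iff_exists.2 ⟨x, Nat.Partrec.Code.evaln_mono hmn hx⟩
  · intro a
    have hdom : p a ↔ ∃ x, x ∈ Nat.Partrec.Code.eval c (Encodable.encode a) := by
      rw [hc]
      simp [Part.mem_assert_iff]
    simp only [hdom, Nat.Partrec.Code.evaln_complete, Option.isSome_iff_exists, Option.mem_def]
    exact exists_comm

theorem rePred_exists_stage {v : α → ℕ → Prop} (hv : PrimrecRel v) :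
    REPred fun a => ∃ n, v a n := by
  classical
  have hsearch : Partrec fun a => Nat.rfind fun n => Part.some (decide (v a n)) :=
    Partrec.rfind hv.decide.to_comp.partrec.to₂
  exact hsearch.dom_re.of_eq fun a => Nat.rfind_dom.trans (by simp)

theorem rePred_of_primrecPred {p : α → Prop} (hp : PrimrecPred p) : REPred p :=
  hp.computablePred.to_re

theorem rePred_comp {p : β → Prop} (hp : REPred p) {f : α → β} (hf : Computable f) :
    REPred fun a => p (f a) :=
  Partrec.comp hp hf

theorem rePred_and {p q : α → Prop} (hp : REPred p) (hq : REPred q) :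
    REPred fun a => p a ∧ q a :=
  (Partrec.bind hp (Partrec.to₂ (rePred_comp hq Computable.fst))).dom_re.of_eq fun a => by
    simp [Part.assert]

theorem rePred_or {p q : α → Prop} (hp : REPred p) (hq : REPred q) :
    REPred fun a => p a ∨ q a := by
  obtain ⟨k, hk, hkdom⟩ := Partrec.merge' hp hq
  exact hk.dom_re.of_eq fun a => by simpa [Part.assert] using (hkdom a).2

theorem rePred_exists {p : α → β → Prop} (hp : REPred fun q : α × β => p q.1 q.2) :
    REPred fun a => ∃ b, p a b := by
  obtain ⟨v, hv, -, hpv⟩ := exists_stages hp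
  have hstage : PrimrecRel fun (a : α) (n : ℕ) =>
      ∃ b ∈ (Encodable.decode (α := β) n.unpair.1).toList, v (a, b) n.unpair.2 := by
    have : PrimrecRel fun (b : β) (q : α × ℕ) => v (q.1, b) q.2.unpair.2 :=
      hv.comp ((Primrec.fst.comp Primrec.snd).pair Primrec.fst)
        (Primrec.snd.comp (Primrec.unpair.comp (Primrec.snd.comp Primrec.snd)))
    exact this.exists_mem_list.comp (Primrec.optionToList.comp (Primrec.decode.comp
      (Primrec.fst.comp (Primrec.unpair.comp Primrec.snd)))) Primrec.id
  refine (rePred_exists_stage hstage).of_eq fun a => ⟨?_, ?_⟩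
  · rintro ⟨n, b, -, hb⟩
    exact ⟨b, (hpv _).2 ⟨_, hb⟩⟩
  · rintro ⟨b, hb⟩
    obtain ⟨n, hn⟩ := (hpv (a, b)).1 hb
    exact ⟨Nat.pair (Encodable.encode b) n, b, by simp, by simpa using hn⟩

theorem rePred_forall_mem {p : α → β → Prop} (hp : REPred fun q : α × β => p q.1 q.2)
    {l : α → List β} (hl : Computable l) : REPred fun a => ∀ b ∈ l a, p a b := by
  obtain ⟨v, hv, hmono, hpv⟩ := exists_stages hp
  have hstage : PrimrecRel fun (q : α × List β) (n : ℕ) => ∀ b ∈ q.2, v (q.1, b) n := by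
    have : PrimrecRel fun (b : β) (q : α × ℕ) => v (q.1, b) q.2 :=
      hv.comp ((Primrec.fst.comp Primrec.snd).pair Primrec.fst) (Primrec.snd.comp Primrec.snd)
    exact this.forall_mem_list.comp (Primrec.snd.comp Primrec.fst)
      ((Primrec.fst.comp Primrec.fst).pair Primrec.snd)
  refine (rePred_comp (rePred_exists_stage hstage) (Computable.id.pair hl)).of_eq
    fun a => ⟨?_, fun h => ?_⟩
  · rintro ⟨n, hn⟩ b hb
    exact (hpv _).2 ⟨n, hn b hb⟩
  · choose! f hf using fun b hb => (hpv (a, b)).1 (h b hb)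
    obtain ⟨N, hN⟩ := ((List.finite_toSet (l a)).image f).bddAbove
    exact ⟨N, fun b hb => hmono _ (hN ⟨b, hb, rfl⟩) (hf b hb)⟩

theorem primrecRel_mem_list : PrimrecRel fun (a : α) (l : List α) => a ∈ l := by
  have h : PrimrecRel fun (l : List α) (a : α) => ∃ b ∈ l, b = a :=
    PrimrecRel.exists_mem_list Primrec.eq
  exact (h.comp Primrec.snd Primrec.fst).of_eq fun q => by simp

theorem rePred_exists_mem {p : α → β → Prop} (hp : REPred fun q : α × β => p q.1 q.2)
    {l : α → List β} (hl : Computable l) : REPred fun a => ∃ b ∈ l a, p a b :=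
  rePred_exists <| rePred_and
    (rePred_comp (rePred_of_primrecPred primrecRel_mem_list)
      (Computable.snd.pair (hl.comp Computable.fst))) hp

theorem exists_computable_range {A : Set ℕ} (hA : REPred (· ∈ A)) (hne : A.Nonempty) :
    ∃ e : ℕ → ℕ, Computable e ∧ Set.range e = A := by
  classical
  obtain ⟨v, hv, -, hAv⟩ := exists_stages hA
  obtain ⟨a, ha⟩ := hne
  have hv' : PrimrecPred fun n : ℕ => v n.unpair.1 n.unpair.2 :=
    hv.comp (Primrec.fst.comp Primrec.unpair) (Primrec.snd.comp Primrec.unpair)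
  refine ⟨fun n => if v n.unpair.1 n.unpair.2 then n.unpair.1 else a,
    (Primrec.ite hv' (Primrec.fst.comp Primrec.unpair) (Primrec.const a)).to_comp,
    Set.Subset.antisymm ?_ fun x hx => ?_⟩
  · rintro _ ⟨n, rfl⟩
    dsimp only
    split_ifs with hn
    exacts [(hAv _).2 ⟨_, hn⟩, ha]
  · obtain ⟨n, hn⟩ := (hAv x).1 hx
    exact ⟨Nat.pair x n, by simp [hn]⟩

end RecursivelyEnumerable

section UniformlyRE

variable {α β : Type*} [Primcodable α] [Primcodable β]

/-- The sets `G a` are r.e. uniformly in the parameter `a`. -/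
def UniformlyRE (G : α → Set ℕ) : Prop := REPred fun p : α × ℕ => p.2 ∈ G p.1

theorem UniformlyRE.rePred_mem {G : α → Set ℕ} (hG : UniformlyRE G) {f : β → α} {g : β → ℕ}
    (hf : Computable f) (hg : Computable g) : REPred fun b => g b ∈ G (f b) :=
  rePred_comp hG (hf.pair hg)

theorem UniformlyRE.comp {G : α → Set ℕ} (hG : UniformlyRE G) {f : β → α} (hf : Computable f) :
    UniformlyRE fun b => G (f b) :=
  hG.rePred_mem (hf.comp Computable.fst) Computable.snd

theorem UniformlyRE.rePred {G : α → Set ℕ} (hG : UniformlyRE G) (a : α) : REPred (· ∈ G a) :=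
  hG.rePred_mem (Computable.const a) Computable.id

theorem UniformlyRE.union {G H : α → Set ℕ} (hG : UniformlyRE G) (hH : UniformlyRE H) :
    UniformlyRE fun a => G a ∪ H a :=
  rePred_or hG hH

theorem uniformlyRE_const {A : Set ℕ} (hA : REPred (· ∈ A)) : UniformlyRE fun _ : α => A :=
  rePred_comp hA Computable.snd

theorem UniformlyRE.biUnion_fiber {G : α → Set ℕ} (hG : UniformlyRE G) {f : α → β}
    (hf : Computable f) : UniformlyRE fun b => ⋃ a ∈ f ⁻¹' {b}, G a := by
  classical
  have : REPred fun p : β × ℕ => ∃ a, f a = p.1 ∧ p.2 ∈ G a :=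
    rePred_exists (p := fun (p : β × ℕ) a => f a = p.1 ∧ p.2 ∈ G a) <| rePred_and
      (rePred_comp (rePred_of_primrecPred Primrec.eq)
        ((hf.comp Computable.snd).pair (Computable.fst.comp Computable.fst)))
      (hG.rePred_mem Computable.snd (Computable.snd.comp Computable.fst))
  exact this.of_eq fun p => by simp

theorem UniformlyRE.biUnion {I : Set ℕ} (hI : REPred (· ∈ I)) {G : ℕ → Set ℕ}
    (hG : UniformlyRE G) : REPred (· ∈ ⋃ i ∈ I, G i) := by
  have : REPred fun x => ∃ i, i ∈ I ∧ x ∈ G i :=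
    rePred_exists <| rePred_and (rePred_comp hI Computable.snd)
      (hG.rePred_mem Computable.snd Computable.fst)
  exact this.of_eq fun x => by simp

theorem uniformlyRE_image_Iio {e : ℕ → ℕ} (he : Computable e) :
    UniformlyRE fun n => e '' Set.Iio n := by
  have : REPred fun p : ℕ × ℕ => ∃ i ∈ List.range p.1, e i = p.2 :=
    rePred_exists_mem (p := fun p i => e i = p.2)
      (rePred_comp (rePred_of_primrecPred Primrec.eq)
        ((he.comp Computable.snd).pair (Computable.snd.comp Computable.fst)))
      (Primrec.list_range.comp Primrec.fst).to_comp
  exact this.of_eq fun p => by simp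

theorem IsPositive.rePred {η : Setoid ℕ} (hη : IsPositive η) {f g : α → ℕ} (hf : Computable f)
    (hg : Computable g) : REPred fun a => η (f a) (g a) :=
  rePred_comp hη.re (hf.pair hg)

theorem UniformlyRE.etaClosure {η : Setoid ℕ} (hη : IsPositive η) {G : α → Set ℕ}
    (hG : UniformlyRE G) : UniformlyRE fun a => etaClosure η (G a) :=
  rePred_exists <| rePred_and
    (hG.rePred_mem (Computable.fst.comp Computable.fst) Computable.snd)
    (hη.rePred Computable.snd (Computable.snd.comp Computable.fst))

end UniformlyRE

section Closure

variable {η : Setoid ℕ}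

theorem subset_etaClosure (D : Set ℕ) : D ⊆ etaClosure η D := fun x hx => ⟨x, hx, η.refl x⟩

theorem etaClosed_etaClosure (D : Set ℕ) : EtaClosed η (etaClosure η D) :=
  fun _ _ hxy ⟨z, hz, hzx⟩ => ⟨z, hz, η.trans hzx hxy⟩

theorem etaClosure_mono {D E : Set ℕ} (h : D ⊆ E) : etaClosure η D ⊆ etaClosure η E :=
  fun _ ⟨x, hx, hxy⟩ => ⟨x, h hx, hxy⟩

theorem EtaClosed.etaClosure_subset {A D : Set ℕ} (hA : EtaClosed η A) (h : D ⊆ A) :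
    etaClosure η D ⊆ A :=
  fun y ⟨x, hx, hxy⟩ => hA x y hxy (h hx)

theorem EtaClosed.etaClosure_eq {A : Set ℕ} (hA : EtaClosed η A) : etaClosure η A = A :=
  (hA.etaClosure_subset subset_rfl).antisymm (subset_etaClosure A)

theorem EtaClosed.mk_mem_image {A : Set ℕ} (hA : EtaClosed η A) {x : ℕ} :
    Quotient.mk η x ∈ Quotient.mk η '' A ↔ x ∈ A :=
  ⟨fun ⟨y, hy, hyx⟩ => hA y x (Quotient.exact hyx) hy, fun hx => ⟨x, hx, rfl⟩⟩

theorem EtaClosed.eq_of_image_eq {A B : Set ℕ} (hA : EtaClosed η A) (hB : EtaClosed η B)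
    (h : Quotient.mk η '' A = Quotient.mk η '' B) : A = B := by
  ext x
  rw [← hA.mk_mem_image, h, hB.mk_mem_image]

theorem image_mk_etaClosure (D : Set ℕ) :
    Quotient.mk η '' etaClosure η D = Quotient.mk η '' D :=
  Set.Subset.antisymm
    (fun _ ⟨_, ⟨x, hx, hxy⟩, h⟩ => ⟨x, hx, (Quotient.sound hxy).trans h⟩)
    (Set.image_mono (subset_etaClosure D))

theorem EtaClosed.biUnion {ι : Type*} {I : Set ι} {B : ι → Set ℕ} (hB : ∀ i, EtaClosed η (B i)) :
    EtaClosed η (⋃ i ∈ I, B i) := by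
  intro x y hxy hx
  simp only [Set.mem_iUnion] at hx ⊢
  obtain ⟨i, hi, hxi⟩ := hx
  exact ⟨i, hi, hB i x y hxy hxi⟩

theorem etaInfinite_univ (hη : IsPositive η) : EtaInfinite η Set.univ := by
  have := hη.infinite_classes
  refine ⟨fun _ _ _ _ => trivial, ?_⟩
  rw [Set.image_univ, Set.range_eq_univ.2 Quotient.mk_surjective]
  exact Set.infinite_univ

end Closure

section Chain

/-- The number of `η`-classes met by `e 0, …, e (n - 1)`. -/
noncomputable def classCount (η : Setoid ℕ) (e : ℕ → ℕ) (n : ℕ) : ℕ :=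
  (Quotient.mk η '' (e '' Set.Iio n)).ncard

/-- The union of the first `k` distinct `η`-classes occurring in the sequence `e`. -/
def chain (η : Setoid ℕ) (e : ℕ → ℕ) (k : ℕ) : Set ℕ :=
  {x | ∃ n, x ∈ etaClosure η (e '' Set.Iio n) ∧ classCount η e n ≤ k}

variable {η : Setoid ℕ} {e : ℕ → ℕ}

theorem finite_classes_Iio (η : Setoid ℕ) (e : ℕ → ℕ) (n : ℕ) :
    (Quotient.mk η '' (e '' Set.Iio n)).Finite :=
  ((Set.finite_Iio n).image e).image _

theorem classCount_mono : Monotone (classCount η e) := fun _ _ h =>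
  Set.ncard_le_ncard (Set.image_mono (Set.image_mono (Set.Iio_subset_Iio h)))
    (finite_classes_Iio η e _)

theorem classCount_le (n : ℕ) : classCount η e n ≤ n :=
  calc classCount η e n ≤ (e '' Set.Iio n).ncard :=
        Set.ncard_image_le ((Set.finite_Iio n).image e)
    _ ≤ (Set.Iio n).ncard := Set.ncard_image_le (Set.finite_Iio n)
    _ = n := by rw [Set.ncard_eq_toFinset_card']; simp

theorem classCount_succ {n : ℕ} (h : e n ∉ etaClosure η (e '' Set.Iio n)) :
    classCount η e (n + 1) = classCount η e n + 1 := by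
  rw [← (etaClosed_etaClosure _).mk_mem_image, image_mk_etaClosure] at h
  rw [classCount, ← Order.succ_eq_add_one, Order.Iio_succ_eq_insert, Set.image_insert_eq,
    Set.image_insert_eq, Set.ncard_insert_of_notMem h (finite_classes_Iio η e n), classCount]

theorem ncard_classes_le_iff {D : Set ℕ} (hD : D.Finite) (k : ℕ) :
    (Quotient.mk η '' D).ncard ≤ k ↔ ∃ l : List ℕ, l.length ≤ k ∧ ∀ x ∈ D, ∃ w ∈ l, η x w := by
  classical
  have hfin : (Quotient.mk η '' D).Finite := hD.image _
  constructor
  · intro h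
    refine ⟨hfin.toFinset.toList.map Quotient.out, ?_, fun x hx =>
      ⟨(Quotient.mk η x).out, List.mem_map_of_mem ?_, η.symm (Quotient.mk_out x)⟩⟩
    · simpa [Set.ncard_eq_toFinset_card _ hfin] using h
    · simpa using ⟨x, hx, rfl⟩
  · rintro ⟨l, hl, h⟩
    have hsub : Quotient.mk η '' D ⊆ (l.map (Quotient.mk η)).toFinset := by
      rintro _ ⟨x, hx, rfl⟩
      obtain ⟨w, hw, hxw⟩ := h x hx
      simpa using ⟨w, hw, Quotient.sound (η.symm hxw)⟩
    calc _ ≤ (l.map (Quotient.mk η)).toFinset.card := by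
          simpa only [Set.ncard_coe_finset] using Set.ncard_le_ncard hsub (Finset.finite_toSet _)
      _ ≤ (l.map (Quotient.mk η)).length := List.toFinset_card_le _
      _ ≤ k := by simpa using hl

theorem rePred_classCount_le (hη : IsPositive η) (he : Computable e) :
    REPred fun p : ℕ × ℕ => classCount η e p.1 ≤ p.2 := by
  have hcover : REPred fun q : (ℕ × ℕ) × List ℕ =>
      ∀ i ∈ List.range q.1.1, ∃ w ∈ q.2, η (e i) w :=
    rePred_forall_mem (p := fun q i => ∃ w ∈ q.2, η (e i) w)
      (rePred_exists_mem (p := fun q w => η (e q.2) w)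
        (hη.rePred (he.comp (Computable.snd.comp Computable.fst)) Computable.snd)
        (Computable.snd.comp Computable.fst))
      (Primrec.list_range.comp (Primrec.fst.comp Primrec.fst)).to_comp
  have hlength : REPred fun q : (ℕ × ℕ) × List ℕ => q.2.length ≤ q.1.2 :=
    rePred_of_primrecPred (Primrec.nat_le.comp (Primrec.list_length.comp Primrec.snd)
      (Primrec.snd.comp Primrec.fst))
  refine (rePred_exists (p := fun p (l : List ℕ) => l.length ≤ p.2 ∧
    ∀ i ∈ List.range p.1, ∃ w ∈ l, η (e i) w) (rePred_and hlength hcover)).of_eq fun p => ?_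
  rw [classCount, ncard_classes_le_iff ((Set.finite_Iio _).image e)]
  simp

theorem uniformlyRE_chain (hη : IsPositive η) (he : Computable e) : UniformlyRE (chain η e) := by
  have hmem : REPred fun q : (ℕ × ℕ) × ℕ => q.1.2 ∈ etaClosure η (e '' Set.Iio q.2) :=
    ((uniformlyRE_image_Iio he).etaClosure hη).rePred_mem Computable.snd
      (Computable.snd.comp Computable.fst)
  have hcount : REPred fun q : (ℕ × ℕ) × ℕ => classCount η e q.2 ≤ q.1.1 :=
    rePred_comp (f := fun q : (ℕ × ℕ) × ℕ => (q.2, q.1.1)) (rePred_classCount_le hη he)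
      (Computable.snd.pair (Computable.fst.comp Computable.fst))
  exact rePred_exists (rePred_and hmem hcount)

theorem etaClosed_chain (k : ℕ) : EtaClosed η (chain η e k) :=
  fun x y hxy ⟨n, hx, hn⟩ => ⟨n, etaClosed_etaClosure _ x y hxy hx, hn⟩

theorem mem_chain {i k : ℕ} (h : i < k) : e i ∈ chain η e k :=
  ⟨k, subset_etaClosure _ ⟨i, h, rfl⟩, classCount_le k⟩

theorem chain_subset {A : Set ℕ} (hA : EtaClosed η A) (he : ∀ n, e n ∈ A) (k : ℕ) :
    chain η e k ⊆ A :=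
  fun _ ⟨_, hx, _⟩ => hA.etaClosure_subset (Set.image_subset_iff.2 fun i _ => he i) hx

theorem chain_eq_of_notMem {n : ℕ} (h : e n ∉ etaClosure η (e '' Set.Iio n)) :
    chain η e (classCount η e n) = etaClosure η (e '' Set.Iio n) := by
  refine Set.Subset.antisymm ?_ fun x hx => ⟨n, hx, le_rfl⟩
  rintro x ⟨m, hx, hm⟩
  have hmn : m ≤ n := by
    by_contra! hnm
    have := classCount_mono (η := η) (e := e) (Nat.succ_le_of_lt hnm)
    rw [Nat.succ_eq_add_one, classCount_succ h] at this
    omega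
  exact etaClosure_mono (Set.image_mono (Set.Iio_subset_Iio hmn)) hx

theorem exists_isLeast_notMem_etaClosure (hinf : (Quotient.mk η '' Set.range e).Infinite) (n : ℕ) :
    ∃ m, IsLeast {i | e i ∉ etaClosure η (e '' Set.Iio n)} m := by
  suffices h : {i | e i ∉ etaClosure η (e '' Set.Iio n)}.Nonempty from
    ⟨_, Nat.sInf_mem h, fun _ => Nat.sInf_le⟩
  by_contra! h
  refine hinf ((finite_classes_Iio η e n).subset ?_)
  rw [← image_mk_etaClosure (e '' _)]
  exact Set.image_mono <| Set.range_subset_iff.2 fun i =>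
    not_not.1 (Set.eq_empty_iff_forall_notMem.1 h i)

theorem exists_classCount_eq (hinf : (Quotient.mk η '' Set.range e).Infinite) (k : ℕ) :
    ∃ n, classCount η e n = k ∧ e n ∉ etaClosure η (e '' Set.Iio n) := by
  induction k with
  | zero => exact ⟨0, by simp [classCount], by simp [etaClosure]⟩
  | succ k ih =>
    obtain ⟨n, hn, hnew⟩ := ih
    obtain ⟨m, hm, hleast⟩ := exists_isLeast_notMem_etaClosure hinf (n + 1)
    have hnm : n + 1 ≤ m := by
      by_contra! h
      exact hm (subset_etaClosure _ ⟨m, h, rfl⟩)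
    have hclosure : etaClosure η (e '' Set.Iio m) = etaClosure η (e '' Set.Iio (n + 1)) := by
      refine Set.Subset.antisymm ((etaClosed_etaClosure _).etaClosure_subset ?_)
        (etaClosure_mono (Set.image_mono (Set.Iio_subset_Iio hnm)))
      rintro _ ⟨i, hi, rfl⟩
      exact not_not.1 fun h => (hleast h).not_gt hi
    refine ⟨m, ?_, hclosure ▸ hm⟩
    rw [classCount, ← image_mk_etaClosure, hclosure, image_mk_etaClosure, ← classCount,
      classCount_succ hnew, hn]

theorem exists_chain_eq (hinf : (Quotient.mk η '' Set.range e).Infinite) (k : ℕ) :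
    ∃ n, IsLeast {i | e i ∉ chain η e k} n ∧ chain η e k = etaClosure η (e '' Set.Iio n) := by
  obtain ⟨n, rfl, hn⟩ := exists_classCount_eq hinf k
  rw [chain_eq_of_notMem hn]
  refine ⟨n, ⟨hn, fun i hi => ?_⟩, rfl⟩
  by_contra! h
  exact hi (subset_etaClosure _ ⟨i, h, rfl⟩)

theorem ncard_classes_chain (hinf : (Quotient.mk η '' Set.range e).Infinite) (k : ℕ) :
    (Quotient.mk η '' chain η e k).ncard = k := by
  obtain ⟨n, rfl, hn⟩ := exists_classCount_eq hinf k
  rw [chain_eq_of_notMem hn, image_mk_etaClosure, classCount]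

theorem finite_classes_chain (hinf : (Quotient.mk η '' Set.range e).Infinite) (k : ℕ) :
    (Quotient.mk η '' chain η e k).Finite := by
  obtain ⟨n, -, hn⟩ := exists_chain_eq hinf k
  rw [hn, image_mk_etaClosure]
  exact finite_classes_Iio η e n

theorem chain_injective (hinf : (Quotient.mk η '' Set.range e).Infinite) :
    Function.Injective (chain η e) :=
  Function.LeftInverse.injective (g := fun L => (Quotient.mk η '' L).ncard)
    (ncard_classes_chain hinf)

theorem chain_one (hinf : (Quotient.mk η '' Set.range e).Infinite) :
    chain η e 1 = etaClosure η {e 0} := by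
  refine ((etaClosed_chain 1).eq_of_image_eq (etaClosed_etaClosure _)) ?_
  obtain ⟨q, hq⟩ := Set.ncard_eq_one.1 (ncard_classes_chain hinf 1)
  have : Quotient.mk η (e 0) ∈ Quotient.mk η '' chain η e 1 := ⟨_, mem_chain one_pos, rfl⟩
  rw [hq, Set.mem_singleton_iff] at this
  rw [image_mk_etaClosure, Set.image_singleton, hq, this]

end Chain

section Families

variable {η : Setoid ℕ}

theorem isEtaFamily_range {α : Type*} [Denumerable α] {B : α → Set ℕ} (hB : UniformlyRE B)
    (hinj : Function.Injective B) (hclosed : ∀ a, EtaClosed η (B a)) :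
    IsEtaFamily η (Set.range B) :=
  ⟨fun n => B (Denumerable.ofNat α n), hB.comp (Computable.ofNat α),
    hinj.comp (Denumerable.eqv α).symm.injective,
    (Denumerable.eqv α).symm.surjective.range_comp B, fun _ => hclosed _⟩

theorem IsEtaFamily.union {L H : Set (Set ℕ)} (hL : IsEtaFamily η L) (hH : IsEtaFamily η H)
    (hdisj : Disjoint L H) : IsEtaFamily η (L ∪ H) := by
  obtain ⟨B, hB, hBinj, rfl, hBclosed⟩ := hL
  obtain ⟨C, hC, hCinj, rfl, hCclosed⟩ := hH
  rw [← Set.Sum.elim_range]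
  refine isEtaFamily_range ?_ (hBinj.sumElim hCinj (Set.disjoint_range_iff.1 hdisj))
    (Sum.forall.2 ⟨hBclosed, hCclosed⟩)
  have hfibers := (UniformlyRE.biUnion_fiber hB (Primrec.sumInl (β := ℕ)).to_comp).union
    (UniformlyRE.biUnion_fiber hC (Primrec.sumInr (α := ℕ)).to_comp)
  refine hfibers.of_eq ?_
  rintro ⟨i | j, x⟩ <;> simp

protected theorem IsEtaFamily.insert {C : Set (Set ℕ)} (hC : IsEtaFamily η C) {A : Set ℕ}
    (hA : REPred (· ∈ A)) (hclosed : EtaClosed η A) (hAC : A ∉ C) :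
    IsEtaFamily η (insert A C) := by
  obtain ⟨B, hB, hBinj, rfl, hBclosed⟩ := hC
  have hrange : insert A (Set.range B) = Set.range fun o : Option ℕ => o.elim A B := by
    rw [Set.insert_eq, Option.range_eq]
    rfl
  rw [hrange]
  refine isEtaFamily_range ?_ (Option.injective_iff.2 ⟨hBinj, hAC⟩)
    (Option.forall.2 ⟨hclosed, hBclosed⟩)
  have hfibers := (UniformlyRE.biUnion_fiber hB Computable.option_some).union
    (UniformlyRE.biUnion_fiber (uniformlyRE_const hA) (Computable.const (α := Unit) none))
  refine hfibers.of_eq ?_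
  rintro ⟨_ | i, x⟩ <;> simp

end Families

section Texts

/-- The set of numbers occurring in the sequence `σ`, pauses being ignored. -/
def content (σ : List (Option ℕ)) : Set ℕ := {x | some x ∈ σ}

@[simp] theorem mem_content {σ : List (Option ℕ)} {x : ℕ} : x ∈ content σ ↔ some x ∈ σ := Iff.rfl

theorem content_append (σ τ : List (Option ℕ)) : content (σ ++ τ) = content σ ∪ content τ := by
  ext x
  simp

theorem finite_content (σ : List (Option ℕ)) : (content σ).Finite :=
  (List.finite_toSet σ).preimage (Option.some_injective ℕ).injOn

theorem uniformlyRE_content : UniformlyRE content :=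
  rePred_of_primrecPred <|
    primrecRel_mem_list.comp (Primrec.option_some.comp Primrec.snd) Primrec.fst

theorem UniformlyRE.rePred_content_subset {α β : Type*} [Primcodable α] [Primcodable β]
    {G : α → Set ℕ} (hG : UniformlyRE G) {f : β → List (Option ℕ)} {g : β → α}
    (hf : Computable f) (hg : Computable g) : REPred fun b => content (f b) ⊆ G (g b) := by
  have hnumbers : Computable fun b => (f b).reduceOption :=
    (Primrec.listFilterMap Primrec.id Primrec₂.right).to_comp.comp hf
  refine (rePred_forall_mem (p := fun b x => x ∈ G (g b))
    (hG.rePred_mem (hg.comp Computable.fst) Computable.snd) hnumbers).of_eq fun b => ?_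
  simp [Set.subset_def, List.reduceOption_mem_iff]

@[simp] theorem length_seg (T : ℕ → Option ℕ) (n : ℕ) : (seg T n).length = n := by simp [seg]

theorem take_seg (T : ℕ → Option ℕ) {i n : ℕ} (h : i ≤ n) : (seg T n).take i = seg T i := by
  simp [seg, ← List.map_take, List.take_range, h]

theorem mem_content_seg {T : ℕ → Option ℕ} {n x : ℕ} :
    x ∈ content (seg T n) ↔ ∃ i < n, T i = some x := by
  simp [seg]

theorem isText_iff {T : ℕ → Option ℕ} {L : Set ℕ} :
    IsText T L ↔ ⋃ n, content (seg T n) = L := by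
  have h (x : ℕ) : x ∈ ⋃ n, content (seg T n) ↔ ∃ n, T n = some x := by
    simp only [Set.mem_iUnion, mem_content_seg]
    exact ⟨fun ⟨_, i, _, hi⟩ => ⟨i, hi⟩, fun ⟨i, hi⟩ => ⟨i + 1, i, i.lt_succ_self, hi⟩⟩
  simp only [IsText, Set.ext_iff, h]
  exact forall_congr' fun x => Iff.comm

theorem IsText.content_subset {T : ℕ → Option ℕ} {L : Set ℕ} (hT : IsText T L) (n : ℕ) :
    content (seg T n) ⊆ L :=
  (Set.subset_iUnion _ n).trans (isText_iff.1 hT).subset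

theorem exists_isText (L : Set ℕ) : ∃ T, IsText T L := by
  classical
  refine ⟨fun n => if n ∈ L then some n else none, fun x => ⟨fun hx => ⟨x, if_pos hx⟩, ?_⟩⟩
  rintro ⟨n, hn⟩
  simp only [Option.ite_none_right_eq_some, Option.some.injEq] at hn
  exact hn.2 ▸ hn.1

theorem exists_isText_of_prefixes {S : ℕ → List (Option ℕ)} (hS : ∀ n, S n <+: S (n + 1))
    (hlen : ∀ n, n ≤ (S n).length) :
    ∃ T, IsText T (⋃ n, content (S n)) ∧ ∀ n, seg T (S n).length = S n := by
  have hmono {m n : ℕ} (h : m ≤ n) : S m <+: S n :=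
    Nat.le_induction List.prefix_rfl (fun k _ ih => ih.trans (hS k)) n h
  let T : ℕ → Option ℕ := fun i => (S (i + 1))[i]'(hlen (i + 1))
  have hget (n i : ℕ) (hi : i < (S n).length) : (S n)[i] = T i := by
    rcases le_total n (i + 1) with h | h
    exacts [(hmono h).getElem hi, ((hmono h).getElem _).symm]
  have hseg (n : ℕ) : seg T (S n).length = S n :=
    List.ext_getElem (by simp) fun i _ hi => by simp [seg, hget n i hi]
  refine ⟨T, isText_iff.2 (Set.Subset.antisymm ?_ ?_), hseg⟩
  · refine Set.iUnion_mono fun n => ?_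
    rw [← hseg n, content, content]
    intro x hx
    obtain ⟨i, hi, hx⟩ := mem_content_seg.1 hx
    exact mem_content_seg.2 ⟨i, hi.trans_le (hlen n), hx⟩
  · exact Set.iUnion_subset fun n => (hseg n ▸ Set.subset_iUnion (fun n => content (seg T n)) _)

theorem exists_isText_extending {σ : List (Option ℕ)} {L : Set ℕ} (hσ : content σ ⊆ L) :
    ∃ T, IsText T L ∧ ∀ n, ∃ τ, content τ ⊆ L ∧ seg T (σ.length + n) = σ ++ τ := by
  obtain ⟨U, hU⟩ := exists_isText L
  obtain ⟨T, hT, hseg⟩ := exists_isText_of_prefixes (S := fun n => σ ++ seg U n)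
    (fun n => List.prefix_append_right_inj σ |>.2 <| by simp [seg, List.range_succ])
    (fun n => by simp)
  refine ⟨T, ?_, fun n => ⟨seg U n, hU.content_subset n, by simpa using hseg n⟩⟩
  convert hT
  simp only [content_append, ← Set.union_iUnion, isText_iff.1 hU, Set.union_eq_right.2 hσ]

theorem exists_locking {L : Set ℕ} {P : List (Option ℕ) → List (Option ℕ) → Prop}
    (h : ∀ T, IsText T L → ∃ n, ∀ m ≥ n, ∀ j ≥ m, P (seg T m) (seg T j)) :
    ∃ σ, content σ ⊆ L ∧ ∀ τ, content τ ⊆ L → P σ (σ ++ τ) := by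
  by_contra! hcon
  choose! f hf hfP using hcon
  obtain ⟨U, hU⟩ := exists_isText L
  -- Interleaving a text for `L` with violations of `P` gives a text along which `P` keeps failing.
  let S : ℕ → List (Option ℕ) := fun n => Nat.rec [] (fun n σ => σ ++ f σ ++ [U n]) n
  have hsucc (n : ℕ) : S (n + 1) = S n ++ f (S n) ++ [U n] := rfl
  have hsub (n : ℕ) : content (S n) ⊆ L := by
    induction n with
    | zero => simp [S, content]
    | succ n ih =>
      rw [hsucc, content_append, content_append]
      refine Set.union_subset (Set.union_subset ih (hf _ ih)) fun x hx => (hU x).2 ⟨n, ?_⟩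
      exact (List.mem_singleton.1 hx).symm
  have hlen (n : ℕ) : n ≤ (S n).length := by
    induction n with
    | zero => exact Nat.zero_le _
    | succ n ih => simp only [hsucc, List.length_append, List.length_singleton]; omega
  obtain ⟨T, hT, hseg⟩ := exists_isText_of_prefixes (S := S)
    (fun n => by rw [hsucc, List.append_assoc]; exact List.prefix_append _ _) hlen
  have hTL : IsText T L := by
    convert hT
    refine (Set.iUnion_subset hsub).antisymm' fun x hx => ?_
    obtain ⟨n, hn⟩ := (hU x).1 hx
    exact Set.mem_iUnion.2 ⟨n + 1, by simp [hsucc, hn]⟩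
  obtain ⟨n, hn⟩ := h T hTL
  have hviolation : seg T (S n ++ f (S n)).length = S n ++ f (S n) := by
    rw [← take_seg T (n := (S (n + 1)).length) (by simp [hsucc]), hseg (n + 1), hsucc,
      List.take_left]
  refine hfP (S n) (hsub n) ?_
  rw [← hviolation]
  conv => arg 1; rw [← hseg n]
  exact hn _ (hlen n) _ (by simp)

end Texts

section Locking

variable {φ : ℕ → ℕ →. ℕ} {η : Setoid ℕ} {M : Learner} {C : Set (Set ℕ)} {L : Set ℕ}

theorem exists_bc_locking (hM : BCLearns φ η M C) (hL : L ∈ C) :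
    ∃ σ, content σ ⊆ L ∧ ∀ τ, content τ ⊆ L → Correct φ η (M (σ ++ τ)) L := by
  refine exists_locking (P := fun _ ρ => Correct φ η (M ρ) L) fun T hT => ?_
  obtain ⟨n, hn⟩ := hM L hL T hT
  exact ⟨n, fun m hm j hj => hn j (hm.trans hj)⟩

theorem exists_vac_locking (hM : VacLearns φ η M C) (hL : L ∈ C) :
    ∃ (σ : List (Option ℕ)) (E : List (Option ℕ)),
      content σ ⊆ L ∧ ∀ τ, content τ ⊆ L → M (σ ++ τ) ∈ E := by
  suffices h : ∃ σ, content σ ⊆ L ∧ ∀ τ, content τ ⊆ L → M (σ ++ τ) ∈ σ.inits.map M from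
    h.imp fun σ hσ => ⟨_, hσ⟩
  refine exists_locking (P := fun σ ρ => M ρ ∈ σ.inits.map M) fun T hT => ?_
  have hfin : ((fun n => M (seg T n)) '' Set.Ici 1).Finite := by
    convert hM.2 L hL T hT using 1
    ext o
    simp [eq_comm]
  obtain ⟨t, -, ht, htM⟩ := Set.exists_subset_image_finite_and
    (p := fun E => (fun n => M (seg T n)) '' Set.Ici 1 ⊆ E).1 ⟨_, subset_rfl, hfin, subset_rfl⟩
  obtain ⟨N, hN⟩ := ht.bddAbove
  refine ⟨N + 1, fun m hm j hj => ?_⟩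
  obtain ⟨n, hn, hMn⟩ := htM ⟨j, (Nat.le_add_left 1 N).trans (hm.trans hj), rfl⟩
  have hnm : n ≤ m := (hN hn).trans (Nat.le_of_succ_le hm)
  exact List.mem_map.2
    ⟨seg T n, (List.mem_inits _ _).2 (take_seg T hnm ▸ List.take_prefix _ _), hMn⟩

theorem Correct.unique {h : Option ℕ} {H : Set ℕ} (hL : Correct φ η h L) (hH : Correct φ η h H) :
    L = H := by
  obtain ⟨e, rfl, rfl⟩ := hL
  obtain ⟨_, ⟨⟩, rfl⟩ := hH
  rfl

theorem BCLearns.exists_correct_append (hM : BCLearns φ η M C) (hL : L ∈ C)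
    {σ : List (Option ℕ)} (hσ : content σ ⊆ L) :
    ∃ τ, content τ ⊆ L ∧ Correct φ η (M (σ ++ τ)) L := by
  obtain ⟨T, hT, hseg⟩ := exists_isText_extending hσ
  obtain ⟨n, hn⟩ := hM L hL T hT
  obtain ⟨τ, hτ, hs⟩ := hseg n
  exact ⟨τ, hτ, hs ▸ hn _ (Nat.le_add_left n _)⟩

theorem exists_telltale (hM : BCLearns φ η M C) (hL : L ∈ C) :
    ∃ D : Set ℕ, D.Finite ∧ D ⊆ L ∧ ∀ H ∈ C, D ⊆ H → H ⊆ L → H = L := by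
  obtain ⟨σ, hσ, hlock⟩ := exists_bc_locking hM hL
  refine ⟨content σ, finite_content σ, hσ, fun H hH hσH hHL => ?_⟩
  obtain ⟨τ, hτ, hcorrect⟩ := hM.exists_correct_append hH hσH
  exact hcorrect.unique (hlock τ (hτ.trans hHL))

end Locking

section Learners

variable {φ : ℕ → ℕ →. ℕ} {η : Setoid ℕ} {α : Type*} [Primcodable α]

theorem exists_index (hφ : IsAcceptable φ) {G : α → Set ℕ} (hG : UniformlyRE G) :
    ∃ c : α → ℕ, Computable c ∧ ∀ a, W φ (c a) = G a := by
  have hfiber := hG.biUnion_fiber Computable.encode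
  obtain ⟨c, hc, hcφ⟩ := hφ.2
    (fun e x => (Part.assert (x ∈ ⋃ a ∈ Encodable.encode ⁻¹' {e}, G a) fun _ => Part.some ()).map
      fun _ => 0)
    (Partrec.map hfiber (Computable.const 0).to₂)
  refine ⟨fun a => c (Encodable.encode a), hc.comp Computable.encode, fun a => ?_⟩
  ext x
  rw [W, ← hcφ]
  simp [PFun.Dom, Part.assert]

theorem exLearnable_of_limit (hφ : IsAcceptable φ) {G : α → Set ℕ} (hG : UniformlyRE G)
    {g : List (Option ℕ) → α} (hg : Computable g) {C : Set (Set ℕ)}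
    (h : ∀ L ∈ C, ∀ T, IsText T L →
      ∃ a, etaClosure η (G a) = L ∧ ∀ᶠ m in Filter.atTop, g (seg T m) = a) :
    ExLearnable φ η C := by
  obtain ⟨c, hc, hW⟩ := exists_index hφ hG
  refine ⟨fun σ => some (c (g σ)), Computable.option_some.comp (hc.comp hg), fun L hL T hT => ?_⟩
  obtain ⟨a, ha, hlim⟩ := h L hL T hT
  obtain ⟨n, hn⟩ := Filter.eventually_atTop.1 hlim
  exact ⟨n, ⟨_, rfl, by rw [hn n le_rfl, hW, ha]⟩, fun j hj => by simp only [hn n le_rfl, hn j hj]⟩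

theorem ExLearnable.vacLearnable {C : Set (Set ℕ)} (h : ExLearnable φ η C) :
    VacLearnable φ η C := by
  obtain ⟨M, hM, hL⟩ := h
  refine ⟨M, hM, fun L hLC T hT => ?_, fun L hLC T hT => ?_⟩ <;>
    obtain ⟨n, hn, hstable⟩ := hL L hLC T hT
  · exact ⟨n, fun j hj => (hstable j hj).symm ▸ hn⟩
  · refine ((Set.finite_Iic n).image fun i => M (seg T i)).subset ?_
    rintro _ ⟨m, -, rfl⟩
    rcases le_total m n with h | h
    exacts [⟨m, h, rfl⟩, ⟨n, Set.self_mem_Iic, (hstable m h).symm⟩]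

theorem ExLearnable.mono {C D : Set (Set ℕ)} (hCD : C ⊆ D) (hD : ExLearnable φ η D) :
    ExLearnable φ η C :=
  hD.imp fun _ hM => ⟨hM.1, fun L hL => hM.2 L (hCD hL)⟩

theorem VacLearnable.bcLearnable {C : Set (Set ℕ)} (h : VacLearnable φ η C) :
    BCLearnable φ η C :=
  h.imp fun _ hM => ⟨hM.1, hM.2.1⟩

theorem exists_primrecRel_approx {V : List (Option ℕ) → ℕ → Prop}
    (hV : REPred fun q : List (Option ℕ) × ℕ => V q.1 q.2) :
    ∃ r : List (Option ℕ) → ℕ → Prop, PrimrecRel r ∧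
      (∀ T m k, r (seg T m) k → ∃ i, V (seg T i) k) ∧
      ∀ T i k, V (seg T i) k → ∀ᶠ m in Filter.atTop, r (seg T m) k := by
  obtain ⟨v, hv, hmono, hVv⟩ := exists_stages hV
  -- `V` is seen to hold at `k` on an initial segment of `σ` within `|σ|` stages.
  refine ⟨fun σ k => ∃ i ∈ List.range (σ.length + 1), v (σ.take i, k) σ.length, ?_,
    fun T m k ⟨i, hi, hvi⟩ => ⟨i, (hVv (_, _)).2 ⟨m, ?_⟩⟩, fun T i k hi => ?_⟩
  · have : PrimrecRel fun (i : ℕ) (q : List (Option ℕ) × ℕ) => v (q.1.take i, q.2) q.1.length :=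
      hv.comp ((Primrec.list_take.comp Primrec.fst (Primrec.fst.comp Primrec.snd)).pair
        (Primrec.snd.comp Primrec.snd)) (Primrec.list_length.comp (Primrec.fst.comp Primrec.snd))
    exact this.exists_mem_list.comp (Primrec.list_range.comp
      (Primrec.succ.comp (Primrec.list_length.comp Primrec.fst))) Primrec.id
  · rw [length_seg, List.mem_range] at hi
    rwa [take_seg T (Nat.lt_succ_iff.1 hi), length_seg] at hvi
  · obtain ⟨s, hs⟩ := (hVv (_, _)).1 hi
    filter_upwards [Filter.eventually_ge_atTop i, Filter.eventually_ge_atTop s] with m him hsm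
    refine ⟨i, by simpa using Nat.lt_succ_of_le him, ?_⟩
    rw [take_seg T him, length_seg]
    exact hmono _ hsm hs

theorem exists_limit_of_isLeast {V : List (Option ℕ) → ℕ → Prop}
    (hV : REPred fun q : List (Option ℕ) × ℕ => V q.1 q.2) :
    ∃ g : List (Option ℕ) → ℕ, Computable g ∧ ∀ T n,
      IsLeast {k | ∀ i, ¬ V (seg T i) k} n → ∀ᶠ m in Filter.atTop, g (seg T m) = n := by
  classical
  obtain ⟨r, hr, hsound, hcomplete⟩ := exists_primrecRel_approx hV
  have hr' : Primrec₂ fun σ k => decide (¬ r σ k) := PrimrecPred.decide (PrimrecPred.not hr)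
  refine ⟨fun σ => (List.range σ.length).findIdx fun k => decide (¬ r σ k),
    (Primrec.list_findIdx (Primrec.list_range.comp Primrec.list_length) hr').to_comp,
    fun T n hn => ?_⟩
  have hunrefuted (m : ℕ) : ¬ r (seg T m) n := fun h =>
    let ⟨i, hi⟩ := hsound T m n h
    hn.1 i hi
  have hrefuted : ∀ᶠ m in Filter.atTop, ∀ k ∈ Set.Iio n, r (seg T m) k := by
    refine (Filter.eventually_all_finite (Set.finite_Iio n)).2 fun k hk => ?_
    have hk' : ¬ ∀ i, ¬ V (seg T i) k := fun h => (hn.2 h).not_gt hk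
    push Not at hk'
    obtain ⟨i, hi⟩ := hk'
    exact hcomplete T i k hi
  filter_upwards [hrefuted, Filter.eventually_gt_atTop n] with m hm hnm
  rw [List.findIdx_eq (by simpa using hnm)]
  refine ⟨by simpa using hunrefuted m, fun k hk => ?_⟩
  simpa using hm k hk

theorem exists_limit_first_missing (hη : IsPositive η) {f : ℕ → ℕ} (hf : Computable f) :
    ∃ g : List (Option ℕ) → ℕ, Computable g ∧ ∀ T L n, EtaClosed η L → IsText T L →
      IsLeast {k | f k ∉ L} n → ∀ᶠ m in Filter.atTop, g (seg T m) = n := by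
  obtain ⟨g, hg, hlim⟩ := exists_limit_of_isLeast
    (V := fun σ k => f k ∈ etaClosure η (content σ))
    ((uniformlyRE_content.etaClosure hη).rePred_mem Computable.fst (hf.comp Computable.snd))
  refine ⟨g, hg, fun T L n hL hT hn => hlim T n ?_⟩
  convert hn with k
  rw [← not_exists, not_iff_not]
  refine ⟨fun ⟨i, hi⟩ => hL.etaClosure_subset (hT.content_subset i) hi, fun hk => ?_⟩
  rw [← isText_iff.1 hT, Set.mem_iUnion] at hk
  exact hk.imp fun i hi => subset_etaClosure _ hi

theorem exLearnable_of_first_missing (hφ : IsAcceptable φ) (hη : IsPositive η) {f : ℕ → ℕ}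
    (hf : Computable f) {G : ℕ → Set ℕ} (hG : UniformlyRE G) {C : Set (Set ℕ)}
    (h : ∀ L ∈ C, EtaClosed η L ∧ ∃ n, IsLeast {k | f k ∉ L} n ∧ etaClosure η (G n) = L) :
    ExLearnable φ η C := by
  obtain ⟨g, hg, hlim⟩ := exists_limit_first_missing hη hf
  refine exLearnable_of_limit hφ hG hg fun L hL T hT => ?_
  obtain ⟨hLclosed, n, hn, hGn⟩ := h L hL
  exact ⟨n, hGn, hlim T L n hLclosed hT hn⟩

theorem exLearnable_chain (hφ : IsAcceptable φ) (hη : IsPositive η) {e : ℕ → ℕ}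
    (he : Computable e) (hinf : (Quotient.mk η '' Set.range e).Infinite) :
    ExLearnable φ η (Set.range (chain η e)) := by
  refine exLearnable_of_first_missing hφ hη he (uniformlyRE_image_Iio he) ?_
  rintro _ ⟨k, rfl⟩
  obtain ⟨n, hn, heq⟩ := exists_chain_eq hinf k
  exact ⟨etaClosed_chain k, n, hn, heq.symm⟩

end Learners

section ProperInfinite

/-- `L` and `H` witness that the learnability notion `I` is not closed under union, in the strong
sense that they are disjoint and both explanatorily learnable. -/
structure IsUnionCounterexample (φ : ℕ → ℕ →. ℕ) (η : Setoid ℕ) (I : Set (Set ℕ) → Prop)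
    (L H : Set (Set ℕ)) : Prop where
  family_left : IsEtaFamily η L
  family_right : IsEtaFamily η H
  disjoint : Disjoint L H
  exLearnable_left : ExLearnable φ η L
  exLearnable_right : ExLearnable φ η H
  not_union : ¬ I (L ∪ H)

variable {φ : ℕ → ℕ →. ℕ} {η : Setoid ℕ}

theorem IsUnionCounterexample.mono {I J : Set (Set ℕ) → Prop} (hJI : ∀ C, J C → I C)
    {L H : Set (Set ℕ)} (h : IsUnionCounterexample φ η I L H) :
    IsUnionCounterexample φ η J L H :=
  { h with not_union := fun hJ => h.not_union (hJI _ hJ) }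

theorem IsUnionCounterexample.family_union {I : Set (Set ℕ) → Prop} {L H : Set (Set ℕ)}
    (h : IsUnionCounterexample φ η I L H) : IsEtaFamily η (L ∪ H) :=
  h.family_left.union h.family_right h.disjoint

theorem exists_subset_chain {e : ℕ → ℕ} {D : Set ℕ} (hD : D.Finite) (hDe : D ⊆ Set.range e) :
    ∃ k, D ⊆ chain η e k := by
  obtain ⟨t, -, ht, rfl⟩ := Set.exists_subset_image_finite_and
    (p := fun E => E = D).1 ⟨D, by rwa [Set.image_univ], hD, rfl⟩
  obtain ⟨k, hk⟩ := ht.bddAbove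
  exact ⟨k + 1, Set.image_subset_iff.2 fun i hi => mem_chain (Nat.lt_succ_of_le (hk hi))⟩

theorem not_bcLearnable_of_chain {e : ℕ → ℕ} (hclosed : EtaClosed η (Set.range e))
    (hinf : (Quotient.mk η '' Set.range e).Infinite) {C : Set (Set ℕ)} (he : Set.range e ∈ C)
    (hchain : Set.range (chain η e) ⊆ C) : ¬ BCLearnable φ η C := by
  rintro ⟨M, -, hM⟩
  obtain ⟨D, hDfin, hD, htelltale⟩ := exists_telltale hM he
  obtain ⟨k, hk⟩ := exists_subset_chain hDfin hD
  have heq : chain η e k = Set.range e := htelltale _ (hchain ⟨k, rfl⟩) hk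
    (chain_subset hclosed Set.mem_range_self k)
  exact hinf (heq ▸ finite_classes_chain hinf k)

theorem exLearnable_insert_chain (hφ : IsAcceptable φ) (hη : IsPositive η) {e : ℕ → ℕ}
    (he : Computable e) (hinf : (Quotient.mk η '' Set.range e).Infinite) {A : Set ℕ}
    (hA : REPred (· ∈ A)) (hclosed : EtaClosed η A) (he0 : e 0 ∉ A) :
    ExLearnable φ η (insert A (Set.range fun k => chain η e (k + 1))) := by
  have hG : UniformlyRE fun n => {x | n = 0 ∧ x ∈ A} ∪ e '' Set.Iio n :=
    UniformlyRE.union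
      (rePred_and (rePred_of_primrecPred (Primrec.eq.comp Primrec.fst (Primrec.const 0)))
        (rePred_comp hA Computable.snd)) (uniformlyRE_image_Iio he)
  refine exLearnable_of_first_missing hφ hη he hG ?_
  rintro _ (rfl | ⟨k, rfl⟩)
  · exact ⟨hclosed, 0, ⟨he0, fun _ _ => Nat.zero_le _⟩, by simp [hclosed.etaClosure_eq]⟩
  · obtain ⟨n, hn, heq⟩ := exists_chain_eq hinf (k + 1)
    have hn0 : n ≠ 0 := by
      rintro rfl
      exact hn.1 (mem_chain k.succ_pos)
    exact ⟨etaClosed_chain _, n, hn, by simp [hn0, heq]⟩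

theorem exists_counterexample_bcLearnable (hφ : IsAcceptable φ) (hη : IsPositive η) {A : Set ℕ}
    (hA : REPred (· ∈ A)) (hAinf : EtaInfinite η A) (hne : A ≠ Set.univ) :
    ∃ L H, IsUnionCounterexample φ η (BCLearnable φ η) L H := by
  obtain ⟨hclosed, hinf⟩ := hAinf
  obtain ⟨e, he, rfl⟩ := exists_computable_range hA hinf.nonempty.of_image
  obtain ⟨d, hd⟩ := (Set.ne_univ_iff_exists_notMem _).1 hne
  let f : ℕ → ℕ := fun n => Nat.casesOn n d e
  have hf : Computable f :=
    Computable.nat_casesOn Computable.id (Computable.const d) (he.comp Computable.snd).to₂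
  have hfinf : (Quotient.mk η '' Set.range f).Infinite :=
    hinf.mono (Set.image_mono (Set.range_subset_iff.2 fun n => ⟨n + 1, rfl⟩))
  have hd_mem (k : ℕ) : d ∈ chain η f (k + 1) := mem_chain k.succ_pos
  have hd_notMem (k : ℕ) : d ∉ chain η e k :=
    fun h => hd (chain_subset hclosed Set.mem_range_self k h)
  refine ⟨Set.range (chain η e), insert (Set.range e) (Set.range fun k => chain η f (k + 1)),
    isEtaFamily_range (uniformlyRE_chain hη he) (chain_injective hinf) etaClosed_chain,
    IsEtaFamily.insert ?_ hA hclosed ?_, ?_, exLearnable_chain hφ hη he hinf,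
    exLearnable_insert_chain hφ hη hf hfinf hA hclosed hd,
    not_bcLearnable_of_chain hclosed hinf (Or.inr (Set.mem_insert _ _)) Set.subset_union_left⟩
  · exact isEtaFamily_range ((uniformlyRE_chain hη hf).comp Computable.succ)
      ((chain_injective hfinf).comp Nat.succ_injective) fun k => etaClosed_chain _
  · rintro ⟨k, hk⟩
    exact hd (hk ▸ hd_mem k)
  · rw [Set.disjoint_left]
    rintro _ ⟨k, rfl⟩ (hk | ⟨l, hl⟩)
    · exact hinf (hk ▸ finite_classes_chain hinf k)
    · exact hd_notMem k (hl ▸ hd_mem l)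

end ProperInfinite

section NoProperInfinite

/-- Every r.e. set that is a union of infinitely many `η`-classes is all of `ℕ`. -/
def OnlyUnivEtaInfinite (η : Setoid ℕ) : Prop :=
  ∀ A : Set ℕ, REPred (· ∈ A) → EtaInfinite η A → A = Set.univ

variable {φ : ℕ → ℕ →. ℕ} {η : Setoid ℕ}

theorem infinite_classes_biUnion {ι : Type*} {I : Set ι} (hI : I.Infinite) {B : ι → Set ℕ}
    (hinj : Function.Injective B) (hclosed : ∀ i, EtaClosed η (B i)) :
    (Quotient.mk η '' ⋃ i ∈ I, B i).Infinite := by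
  intro hfin
  have hclasses : Function.Injective fun i => Quotient.mk η '' B i :=
    fun i j hij => hinj ((hclosed i).eq_of_image_eq (hclosed j) hij)
  refine hI (Set.Finite.of_finite_image (hfin.finite_subsets.subset ?_) hclasses.injOn)
  rintro _ ⟨i, hi, rfl⟩
  exact Set.image_mono (Set.subset_biUnion_of_mem hi)

theorem OnlyUnivEtaInfinite.infinite_setOf_subset (h : OnlyUnivEtaInfinite η) {B : ℕ → Set ℕ}
    (hB : UniformlyRE B) (hinj : Function.Injective B) (hclosed : ∀ i, EtaClosed η (B i))
    {D : Set ℕ} (hD : D.Finite) : {i | D ⊆ B i}.Infinite := by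
  classical
  induction D, hD using Set.Finite.induction_on with
  | empty => simpa using Set.infinite_univ
  | @insert d D _ hDfin ih =>
    intro hJ
    let I : Set ℕ := {i | D ⊆ B i ∧ i ∉ {i | insert d D ⊆ B i}}
    have hI : REPred (· ∈ I) := by
      refine rePred_and ?_ (rePred_of_primrecPred ?_)
      · refine (rePred_forall_mem (p := fun i x => x ∈ B i) (hB.rePred_mem Computable.fst
          Computable.snd) (Computable.const hDfin.toFinset.toList)).of_eq fun i => ?_
        simp [Set.subset_def]
      · refine PrimrecPred.not ((primrecRel_mem_list.comp Primrec.id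
          (Primrec.const hJ.toFinset.toList)).of_eq fun i => ?_)
        simp
    have huniv := h _ (hB.biUnion hI)
      ⟨EtaClosed.biUnion hclosed, infinite_classes_biUnion (ih.sdiff hJ) hinj hclosed⟩
    have hd : d ∈ ⋃ i ∈ I, B i := huniv ▸ Set.mem_univ d
    simp only [Set.mem_iUnion] at hd
    obtain ⟨i, ⟨hDi, hi⟩, hdi⟩ := hd
    exact hi (Set.insert_subset hdi hDi)

theorem OnlyUnivEtaInfinite.univ_notMem (h : OnlyUnivEtaInfinite η) {C : Set (Set ℕ)}
    (hC : IsEtaFamily η C) (hbc : BCLearnable φ η C) : Set.univ ∉ C := by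
  obtain ⟨B, hB, hinj, rfl, hclosed⟩ := hC
  obtain ⟨M, -, hM⟩ := hbc
  intro huniv
  obtain ⟨D, hDfin, -, htelltale⟩ := exists_telltale hM huniv
  refine h.infinite_setOf_subset hB hinj hclosed hDfin
    (Set.Subsingleton.finite fun i hi j hj => hinj ?_)
  rw [htelltale _ ⟨i, rfl⟩ hi (Set.subset_univ _), htelltale _ ⟨j, rfl⟩ hj (Set.subset_univ _)]

theorem OnlyUnivEtaInfinite.finite_classes (h : OnlyUnivEtaInfinite η) {C : Set (Set ℕ)}
    (hC : IsEtaFamily η C) (hbc : BCLearnable φ η C) {L : Set ℕ} (hL : L ∈ C) :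
    EtaClosed η L ∧ (Quotient.mk η '' L).Finite := by
  have huniv := h.univ_notMem hC hbc
  obtain ⟨B, hB, -, rfl, hclosed⟩ := hC
  obtain ⟨k, rfl⟩ := hL
  refine ⟨hclosed k, Set.not_infinite.1 fun hinf => huniv ⟨k, ?_⟩⟩
  exact h _ (UniformlyRE.rePred hB k) ⟨hclosed k, hinf⟩

theorem IsText.eventually_etaClosure_content_eq {T : ℕ → Option ℕ} {L : Set ℕ} (hT : IsText T L)
    (hL : EtaClosed η L) (hfin : (Quotient.mk η '' L).Finite) :
    ∀ᶠ m in Filter.atTop, etaClosure η (content (seg T m)) = L := by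
  have hclass : ∀ q ∈ Quotient.mk η '' L, ∀ᶠ m in Filter.atTop,
      q ∈ Quotient.mk η '' content (seg T m) := by
    rintro _ ⟨x, hx, rfl⟩
    obtain ⟨i, hi⟩ := (hT x).1 hx
    filter_upwards [Filter.eventually_gt_atTop i] with m hm
    exact ⟨x, mem_content_seg.2 ⟨i, hm, hi⟩, rfl⟩
  filter_upwards [(Filter.eventually_all_finite hfin).2 hclass] with m hm
  refine (etaClosed_etaClosure _).eq_of_image_eq hL (Set.Subset.antisymm ?_ ?_)
  · exact Set.image_mono (hL.etaClosure_subset (hT.content_subset m))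
  · rwa [image_mk_etaClosure]

theorem bcLearnable_of_finite_classes (hφ : IsAcceptable φ) {C : Set (Set ℕ)}
    (hC : ∀ L ∈ C, EtaClosed η L ∧ (Quotient.mk η '' L).Finite) : BCLearnable φ η C := by
  obtain ⟨c, hc, hW⟩ := exists_index hφ uniformlyRE_content
  refine ⟨fun σ => some (c σ), Computable.option_some.comp hc, fun L hL T hT => ?_⟩
  obtain ⟨n, hn⟩ := Filter.eventually_atTop.1
    (hT.eventually_etaClosure_content_eq (hC L hL).1 (hC L hL).2)
  exact ⟨n, fun j hj => ⟨_, rfl, by rw [hW, hn j hj]⟩⟩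

theorem OnlyUnivEtaInfinite.closedUnderUnion_bcLearnable (h : OnlyUnivEtaInfinite η)
    (hφ : IsAcceptable φ) : ClosedUnderUnion η (BCLearnable φ η) := by
  intro L H hL hH _ hLbc hHbc
  refine bcLearnable_of_finite_classes hφ ?_
  rintro F (hF | hF)
  exacts [h.finite_classes hL hLbc hF, h.finite_classes hH hHbc hF]

end NoProperInfinite

section Vacillatory

variable {φ : ℕ → ℕ →. ℕ} {η : Setoid ℕ}

theorem etaClosure_pair_eq_iff {a x y : ℕ} (hx : ¬ η a x) :
    etaClosure η {a, x} = etaClosure η {a, y} ↔ η x y := by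
  constructor
  · intro h
    obtain ⟨z, rfl | rfl, hz⟩ := h ▸ subset_etaClosure {a, x} (Set.mem_insert_of_mem a rfl)
    exacts [absurd hz hx, η.symm hz]
  · refine fun h => (etaClosed_etaClosure _).eq_of_image_eq (etaClosed_etaClosure _) ?_
    rw [image_mk_etaClosure, image_mk_etaClosure, Set.image_pair, Set.image_pair,
      Quotient.sound h]

/-- The numbers `y` such that data from the classes of `a` and `y` can drive the learner `M`, after
it has read `σ`, to a hypothesis outside `E`. -/
def escapeSet (η : Setoid ℕ) (M : Learner) (σ E : List (Option ℕ)) (a : ℕ) : Set ℕ :=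
  {y | ∃ τ, content τ ⊆ etaClosure η {a, y} ∧ M (σ ++ τ) ∉ E}

theorem rePred_escapeSet (hη : IsPositive η) {M : Learner} (hM : Computable M)
    (σ E : List (Option ℕ)) (a : ℕ) : REPred (· ∈ escapeSet η M σ E a) := by
  have hpair : UniformlyRE fun y : ℕ => ({a, y} : Set ℕ) :=
    rePred_of_primrecPred <| (Primrec.eq.comp Primrec.snd (Primrec.const a)).or
      (Primrec.eq.comp Primrec.snd Primrec.fst)
  have hE : REPred fun o : Option ℕ => o ∉ E :=
    rePred_of_primrecPred <| PrimrecPred.not <|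
      primrecRel_mem_list.comp Primrec.id (Primrec.const E)
  exact rePred_exists <| rePred_and
    ((hpair.etaClosure hη).rePred_content_subset Computable.snd Computable.fst)
    (rePred_comp hE (hM.comp (Computable.list_append.comp (Computable.const σ) Computable.snd)))

theorem etaClosed_escapeSet {M : Learner} {σ E : List (Option ℕ)} {a : ℕ} :
    EtaClosed η (escapeSet η M σ E a) := by
  rintro x y hxy ⟨τ, hτ, hMτ⟩
  have hsub : etaClosure η {a, x} ⊆ etaClosure η {a, y} :=
    (etaClosed_etaClosure _).etaClosure_subset <| Set.pair_subset
      (subset_etaClosure _ (Set.mem_insert _ _)) ⟨y, Or.inr rfl, η.symm hxy⟩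
  exact ⟨τ, hτ.trans hsub, hMτ⟩

theorem finite_classes_correct_pair (φ : ℕ → ℕ →. ℕ) (η : Setoid ℕ) (E : List (Option ℕ)) (a : ℕ) :
    (Quotient.mk η ''
      {y | ¬ η a y ∧ ∃ o ∈ E, Correct φ η o (etaClosure η {a, y})}).Finite := by
  have hsingle (o : Option ℕ) :
      (Quotient.mk η '' {y | ¬ η a y ∧ Correct φ η o (etaClosure η {a, y})}).Finite := by
    refine Set.Subsingleton.finite ?_
    rintro _ ⟨y, ⟨hy, hyo⟩, rfl⟩ _ ⟨z, ⟨-, hzo⟩, rfl⟩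
    exact Quotient.sound ((etaClosure_pair_eq_iff hy).1 (hyo.unique hzo))
  refine ((List.finite_toSet E).biUnion fun o _ => hsingle o).subset ?_
  rintro _ ⟨y, ⟨hy, o, ho, hyo⟩, rfl⟩
  exact Set.mem_biUnion ho ⟨y, ⟨hy, hyo⟩, rfl⟩

theorem infinite_classes_escapeSet (hη : IsPositive η) {M : Learner} {C : Set (Set ℕ)}
    (hM : BCLearns φ η M C) {a : ℕ} (hC : ∀ y, ¬ η a y → etaClosure η {a, y} ∈ C)
    {σ : List (Option ℕ)} (hσ : content σ ⊆ etaClosure η {a}) (E : List (Option ℕ)) :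
    (Quotient.mk η '' escapeSet η M σ E a).Infinite := by
  intro hfin
  have hall : Set.univ ⊆ escapeSet η M σ E a ∪ etaClosure η {a} ∪
      {y | ¬ η a y ∧ ∃ o ∈ E, Correct φ η o (etaClosure η {a, y})} := by
    rintro y -
    by_cases hy : η a y
    · exact Or.inl (Or.inr ⟨a, rfl, hy⟩)
    obtain ⟨τ, hτ, hcorrect⟩ := hM.exists_correct_append (hC y hy)
      (hσ.trans (etaClosure_mono (Set.singleton_subset_iff.2 (Set.mem_insert a _))))
    by_cases hE : M (σ ++ τ) ∈ E
    · exact Or.inr ⟨hy, _, hE, hcorrect⟩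
    · exact Or.inl (Or.inl ⟨τ, hτ, hE⟩)
  refine (etaInfinite_univ hη).2 (Set.Finite.subset ?_ (Set.image_mono hall))
  rw [Set.image_union, Set.image_union, image_mk_etaClosure]
  exact (hfin.union ((Set.finite_singleton a).image _)).union
    (finite_classes_correct_pair φ η E a)

theorem OnlyUnivEtaInfinite.not_vacLearnable (h : OnlyUnivEtaInfinite η) (hη : IsPositive η)
    {C : Set (Set ℕ)} {a : ℕ} (ha : etaClosure η {a} ∈ C)
    (hC : ∀ y, ¬ η a y → etaClosure η {a, y} ∈ C) : ¬ VacLearnable φ η C := by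
  rintro ⟨M, hMcomp, hM⟩
  obtain ⟨σ, E, hσ, hE⟩ := exists_vac_locking hM ha
  have huniv := h _ (rePred_escapeSet hη hMcomp σ E a)
    ⟨etaClosed_escapeSet, infinite_classes_escapeSet hη hM.1 hC hσ E⟩
  obtain ⟨τ, hτ, hMτ⟩ := huniv ▸ Set.mem_univ a
  rw [Set.pair_eq_singleton] at hτ
  exact hMτ (hE τ hτ)

theorem exists_limit_first_inequivalent (hη : IsPositive η) (a : ℕ) :
    ∃ g : List (Option ℕ) → ℕ, Computable g ∧ ∀ T L, IsText T L → (∃ x ∈ L, ¬ η x a) →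
      ∃ t ∈ L, ¬ η t a ∧ ∀ᶠ m in Filter.atTop, g (seg T m) = t := by
  classical
  let V : List (Option ℕ) → ℕ → Prop := fun σ k =>
    k < σ.length ∧ ∀ x ∈ (σ.getD k none).toList, η x a
  have hV : REPred fun q : List (Option ℕ) × ℕ => V q.1 q.2 :=
    rePred_and (rePred_of_primrecPred
      (Primrec.nat_lt.comp Primrec.snd (Primrec.list_length.comp Primrec.fst)))
      (rePred_forall_mem (p := fun _ x => η x a)
        (hη.rePred Computable.snd (Computable.const a))
        (Primrec.optionToList.comp (Primrec.list_getD none)).to_comp)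
  obtain ⟨g, hg, hlim⟩ := exists_limit_of_isLeast hV
  refine ⟨fun σ => (σ.getD (g σ) none).getD 0, Computable.option_getD
    ((Primrec.list_getD none).to_comp.comp Computable.id hg) (Computable.const 0),
    fun T L hT hx => ?_⟩
  have hex : ∃ k t, T k = some t ∧ ¬ η t a := by
    obtain ⟨x, hx, hxa⟩ := hx
    exact ((hT x).1 hx).imp fun k hk => ⟨x, hk, hxa⟩
  obtain ⟨t, ht, hta⟩ := Nat.find_spec hex
  have hget {k m : ℕ} (hk : k < m) : (seg T m).getD k none = T k := by simp [seg, hk]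
  have hleast : IsLeast {k | ∀ i, ¬ V (seg T i) k} (Nat.find hex) := by
    refine ⟨?_, fun k hk => ?_⟩
    · rintro i ⟨hi, hV⟩
      rw [hget (by simpa using hi)] at hV
      exact hta (hV t (by simp [ht]))
    · by_contra! hlt
      refine hk (k + 1) ⟨by simp, fun x hx => ?_⟩
      rw [hget k.lt_succ_self, Option.mem_toList] at hx
      by_contra hxa
      exact Nat.find_min hex hlt ⟨x, hx, hxa⟩
  refine ⟨t, (hT t).2 ⟨_, ht⟩, hta, ?_⟩
  filter_upwards [hlim T _ hleast, Filter.eventually_gt_atTop (Nat.find hex)] with m hm hlt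
  simp only [hm, hget hlt, ht, Option.getD_some]

open Classical in
/-- The union of the classes of `0` and `i + 1` if `i + 1` is the least element of its class.
Otherwise a chain with an even number of classes, different for different `i`, takes its place, so
that `pairOrChain η` is one-one. -/
noncomputable def pairOrChain (η : Setoid ℕ) (i : ℕ) : Set ℕ :=
  if ∃ z ≤ i, η z (i + 1) then chain η id (2 * i + 4) else etaClosure η {0, i + 1}

theorem infinite_classes_range_id (hη : IsPositive η) :
    (Quotient.mk η '' Set.range id).Infinite := by
  rw [Set.range_id]
  exact (etaInfinite_univ hη).2

theorem etaClosed_pairOrChain (i : ℕ) : EtaClosed η (pairOrChain η i) := by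
  unfold pairOrChain
  split_ifs
  exacts [etaClosed_chain _, etaClosed_etaClosure _]

theorem pair_subset_pairOrChain (i : ℕ) : {0, i + 1} ⊆ pairOrChain η i := by
  unfold pairOrChain
  split_ifs
  · exact Set.pair_subset (mem_chain (e := id) (by omega)) (mem_chain (e := id) (by omega))
  · exact subset_etaClosure _

theorem uniformlyRE_pairOrChain (hη : IsPositive η) : UniformlyRE (pairOrChain η) := by
  have hpair : UniformlyRE fun i : ℕ => ({0, i + 1} : Set ℕ) :=
    rePred_of_primrecPred <| (Primrec.eq.comp Primrec.snd (Primrec.const 0)).or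
      (Primrec.eq.comp Primrec.snd (Primrec.succ.comp Primrec.fst))
  have hrepeated : REPred fun p : ℕ × ℕ => ∃ z ∈ List.range (p.1 + 1), η z (p.1 + 1) :=
    rePred_exists_mem (p := fun p z => η z (p.1 + 1))
      (hη.rePred Computable.snd (Computable.succ.comp (Computable.fst.comp Computable.fst)))
      (Primrec.list_range.comp (Primrec.succ.comp Primrec.fst)).to_comp
  have hchain : UniformlyRE fun i => chain η id (2 * i + 4) :=
    (uniformlyRE_chain hη Computable.id).comp (Primrec.nat_add.comp
      (Primrec.nat_mul.comp (Primrec.const 2) Primrec.id) (Primrec.const 4)).to_comp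
  refine (rePred_or (hpair.etaClosure hη) (rePred_and hrepeated hchain)).of_eq fun ⟨i, x⟩ => ?_
  have hsub := (etaClosed_pairOrChain (η := η) i).etaClosure_subset (pair_subset_pairOrChain i)
  simp only [List.mem_range, Nat.lt_succ_iff]
  unfold pairOrChain at hsub ⊢
  split_ifs at hsub ⊢ with h
  · simpa only [h, true_and] using or_iff_right_of_imp fun hx => hsub hx
  · simp only [h, false_and, or_false]

theorem ncard_classes_pair {a y : ℕ} (h : ¬ η a y) :
    (Quotient.mk η '' etaClosure η {a, y}).ncard = 2 := by
  rw [image_mk_etaClosure, Set.image_pair]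
  exact Set.ncard_pair fun h' => h (Quotient.exact h')

theorem ncard_classes_pairOrChain (hη : IsPositive η) (i : ℕ) :
    (Quotient.mk η '' pairOrChain η i).ncard =
      open Classical in if ∃ z ≤ i, η z (i + 1) then 2 * i + 4 else 2 := by
  unfold pairOrChain
  split_ifs with h
  · exact ncard_classes_chain (infinite_classes_range_id hη) _
  · exact ncard_classes_pair fun h0 => h ⟨0, Nat.zero_le i, h0⟩

theorem pairOrChain_injective (hη : IsPositive η) : Function.Injective (pairOrChain η) := by
  intro i j hij
  have hcard := ncard_classes_pairOrChain hη i
  rw [hij, ncard_classes_pairOrChain hη j] at hcard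
  split_ifs at hcard with hj hi hi
  · omega
  · omega
  · omega
  · rw [pairOrChain, pairOrChain, if_neg hi, if_neg hj,
      etaClosure_pair_eq_iff fun h0 => hi ⟨0, Nat.zero_le i, h0⟩] at hij
    rcases lt_trichotomy i j with hlt | rfl | hlt
    exacts [absurd ⟨i + 1, hlt, hij⟩ hj, rfl, absurd ⟨j + 1, hlt, η.symm hij⟩ hi]

theorem exists_pairOrChain_eq {y : ℕ} (hy : ¬ η 0 y) :
    ∃ i, pairOrChain η i = etaClosure η {0, y} := by
  classical
  have hex : ∃ z, η z y := ⟨y, η.refl y⟩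
  have hspec := Nat.find_spec hex
  obtain ⟨i, hi⟩ := Nat.exists_eq_succ_of_ne_zero fun h0 => hy (h0 ▸ hspec)
  rw [hi] at hspec
  have hleast : ¬ ∃ z ≤ i, η z (i + 1) := fun ⟨z, hz, hzi⟩ =>
    Nat.find_min hex (hi ▸ Nat.lt_succ_of_le hz) (η.trans hzi hspec)
  refine ⟨i, ?_⟩
  rw [pairOrChain, if_neg hleast,
    etaClosure_pair_eq_iff fun h0 => hleast ⟨0, Nat.zero_le i, h0⟩]
  exact hspec

theorem etaClosure_Iio_union_eq_pairOrChain (hη : IsPositive η) {i n t : ℕ}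
    (hn : IsLeast {k | k ∉ pairOrChain η i} n) (ht : t ∈ pairOrChain η i) (ht0 : ¬ η t 0) :
    etaClosure η (Set.Iio n ∪ {t}) = pairOrChain η i := by
  have hbelow : Set.Iio n ⊆ pairOrChain η i := fun k hk =>
    not_not.1 fun h => (hn.2 h).not_gt hk
  refine ((etaClosed_pairOrChain i).etaClosure_subset
    (Set.union_subset hbelow (Set.singleton_subset_iff.2 ht))).antisymm ?_
  have hn0 : n ≠ 0 := by
    rintro rfl
    exact hn.1 (pair_subset_pairOrChain i (Set.mem_insert 0 _))
  unfold pairOrChain at hn ht ⊢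
  split_ifs at hn ht ⊢
  · obtain ⟨n', hn', heq⟩ := exists_chain_eq (infinite_classes_range_id hη) (2 * i + 4)
    rw [heq, hn'.unique hn, Set.image_id]
    exact etaClosure_mono Set.subset_union_left
  · obtain ⟨x, rfl | rfl, hx⟩ := ht
    · exact absurd (η.symm hx) ht0
    · refine (etaClosed_etaClosure _).etaClosure_subset (Set.pair_subset ?_ ?_)
      · exact subset_etaClosure _ (Or.inl (Nat.pos_of_ne_zero hn0))
      · exact ⟨t, Or.inr rfl, η.symm hx⟩

theorem exLearnable_pairOrChain (hφ : IsAcceptable φ) (hη : IsPositive η) :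
    ExLearnable φ η (Set.range (pairOrChain η)) := by
  obtain ⟨g, hg, hglim⟩ := exists_limit_first_missing hη Computable.id
  obtain ⟨d, hd, hdlim⟩ := exists_limit_first_inequivalent hη 0
  have hG : UniformlyRE fun a : ℕ × ℕ => Set.Iio a.1 ∪ {a.2} :=
    rePred_of_primrecPred <| (Primrec.nat_lt.comp Primrec.snd (Primrec.fst.comp Primrec.fst)).or
      (Primrec.eq.comp Primrec.snd (Primrec.snd.comp Primrec.fst))
  refine exLearnable_of_limit hφ hG (hg.pair hd) ?_
  rintro _ ⟨i, rfl⟩ T hT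
  have hcard : 2 ≤ (Quotient.mk η '' pairOrChain η i).ncard := by
    rw [ncard_classes_pairOrChain hη]
    split_ifs <;> omega
  have hmissing : {k | k ∉ pairOrChain η i}.Nonempty := by
    by_contra! h
    have huniv : pairOrChain η i = Set.univ := by simpa [Set.eq_univ_iff_forall,
      Set.eq_empty_iff_forall_notMem] using h
    exact (etaInfinite_univ hη).2 (huniv ▸ Set.finite_of_ncard_pos (by omega))
  have hother : ∃ x ∈ pairOrChain η i, ¬ η x 0 := by
    obtain ⟨_, ⟨x, hx, rfl⟩, hx0⟩ := Set.exists_ne_of_one_lt_ncard hcard (Quotient.mk η 0)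
    exact ⟨x, hx, fun h => hx0 (Quotient.sound h)⟩
  obtain ⟨t, ht, ht0, htlim⟩ := hdlim T _ hT hother
  have hn : IsLeast {k | k ∉ pairOrChain η i} (sInf {k | k ∉ pairOrChain η i}) :=
    ⟨Nat.sInf_mem hmissing, fun _ => Nat.sInf_le⟩
  refine ⟨(_, t), etaClosure_Iio_union_eq_pairOrChain hη hn ht ht0, ?_⟩
  filter_upwards [hglim T _ _ (etaClosed_pairOrChain i) hT hn, htlim] with m hgm hdm
  rw [hgm, hdm]

theorem OnlyUnivEtaInfinite.exists_counterexample_vacLearnable (h : OnlyUnivEtaInfinite η)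
    (hφ : IsAcceptable φ) (hη : IsPositive η) :
    ∃ L H, IsUnionCounterexample φ η (VacLearnable φ η) L H := by
  have hinf := infinite_classes_range_id hη
  refine ⟨Set.range fun k => chain η id (2 * k + 1), Set.range (pairOrChain η), ?_, ?_, ?_, ?_,
    exLearnable_pairOrChain hφ hη, h.not_vacLearnable hη (a := 0) ?_ fun y hy => ?_⟩
  · refine isEtaFamily_range ((uniformlyRE_chain hη Computable.id).comp
      (Primrec.succ.comp (Primrec.nat_mul.comp (Primrec.const 2) Primrec.id)).to_comp)
      (fun i j hij => ?_) fun k => etaClosed_chain _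
    have := chain_injective hinf hij
    omega
  · exact isEtaFamily_range (uniformlyRE_pairOrChain hη) (pairOrChain_injective hη)
      etaClosed_pairOrChain
  · rw [Set.disjoint_left]
    rintro _ ⟨k, rfl⟩ ⟨i, hi⟩
    have hcard := ncard_classes_pairOrChain hη i
    rw [hi, ncard_classes_chain hinf] at hcard
    split_ifs at hcard <;> omega
  · exact ExLearnable.mono (Set.range_comp_subset_range (2 * · + 1) (chain η id))
      (exLearnable_chain hφ hη Computable.id hinf)
  · exact Or.inl ⟨0, chain_one hinf⟩
  · exact Or.inr (exists_pairOrChain_eq hy)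

end Vacillatory

theorem closedUnderUnion_bcLearnable_iff {φ : ℕ → ℕ →. ℕ} {η : Setoid ℕ} (hφ : IsAcceptable φ)
    (hη : IsPositive η) :
    ClosedUnderUnion η (BCLearnable φ η) ↔
      ∀ A : Set ℕ, (REPred (fun x : ℕ => x ∈ A) ∧ EtaInfinite η A) ↔ A = Set.univ := by
  constructor
  · refine fun hclosed A => ⟨fun ⟨hA, hinf⟩ => ?_, ?_⟩
    · by_contra hne
      obtain ⟨L, H, hLH⟩ := exists_counterexample_bcLearnable hφ hη hA hinf hne
      exact hLH.not_union (hclosed L H hLH.family_left hLH.family_right hLH.family_union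
        hLH.exLearnable_left.vacLearnable.bcLearnable
        hLH.exLearnable_right.vacLearnable.bcLearnable)
    · rintro rfl
      exact ⟨(rePred_of_primrecPred (Primrec.eq.comp Primrec.id Primrec.id)).of_eq
        fun x => iff_of_true rfl (Set.mem_univ x), etaInfinite_univ hη⟩
  · intro h
    exact OnlyUnivEtaInfinite.closedUnderUnion_bcLearnable (fun A hA hinf => (h A).1 ⟨hA, hinf⟩) hφ

theorem exists_counterexample_vacLearnable {φ : ℕ → ℕ →. ℕ} {η : Setoid ℕ} (hφ : IsAcceptable φ)
    (hη : IsPositive η) : ∃ L H, IsUnionCounterexample φ η (VacLearnable φ η) L H := by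
  by_cases h : OnlyUnivEtaInfinite η
  · exact h.exists_counterexample_vacLearnable hφ hη
  · unfold OnlyUnivEtaInfinite at h
    push Not at h
    obtain ⟨A, hA, hinf, hne⟩ := h
    obtain ⟨L, H, hLH⟩ := exists_counterexample_bcLearnable hφ hη hA hinf hne
    exact ⟨L, H, hLH.mono fun _ => VacLearnable.bcLearnable⟩

end EtaLearning

theorem theorem5p2 (φ : ℕ → ℕ →. ℕ) (hφ : EtaLearning.IsAcceptable φ)
    (η : Setoid ℕ) (hη : EtaLearning.IsPositive η) :
    (∃ L₁ L₂ : Set (Set ℕ),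
      EtaLearning.IsEtaFamily η L₁ ∧ EtaLearning.IsEtaFamily η L₂ ∧ Disjoint L₁ L₂ ∧
      EtaLearning.ExLearnable φ η L₁ ∧ EtaLearning.ExLearnable φ η L₂ ∧
      EtaLearning.IsEtaFamily η (L₁ ∪ L₂) ∧ ¬ EtaLearning.ExLearnable φ η (L₁ ∪ L₂)) ∧
    (∃ L₁ L₂ : Set (Set ℕ),
      EtaLearning.IsEtaFamily η L₁ ∧ EtaLearning.IsEtaFamily η L₂ ∧ Disjoint L₁ L₂ ∧
      EtaLearning.VacLearnable φ η L₁ ∧ EtaLearning.VacLearnable φ η L₂ ∧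
      EtaLearning.IsEtaFamily η (L₁ ∪ L₂) ∧ ¬ EtaLearning.VacLearnable φ η (L₁ ∪ L₂)) ∧
    (EtaLearning.ClosedUnderUnion η (EtaLearning.BCLearnable φ η) ↔
      ∀ A : Set ℕ, (REPred (fun x : ℕ => x ∈ A) ∧ EtaLearning.EtaInfinite η A) ↔
        A = Set.univ) := by
  obtain ⟨L, H, hvac⟩ := EtaLearning.exists_counterexample_vacLearnable hφ hη
  have hex := hvac.mono fun _ => EtaLearning.ExLearnable.vacLearnable
  refine ⟨⟨L, H, hex.family_left, hex.family_right, hex.disjoint, hex.exLearnable_left,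
      hex.exLearnable_right, hex.family_union, hex.not_union⟩,
    ⟨L, H, hvac.family_left, hvac.family_right, hvac.disjoint,
      hvac.exLearnable_left.vacLearnable, hvac.exLearnable_right.vacLearnable,
      hvac.family_union, hvac.not_union⟩,
    EtaLearning.closedUnderUnion_bcLearnable_iff hφ hη⟩
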